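/- Let $\mathbf{k}$ be a field of characteristic $0$ and let $\tau$ denote the flip $x\otimes y\mapsto y\otimes x$. Let $(A,\cdot,\delta,D,Q)$ be a finite-dimensional commutative and cocommutative differential antisymmetric infinitesimal (ASI) bialgebra over $\mathbf{k}$. That is, $(A,\cdot)$ is a commutative associative algebra over $\mathbf{k}$ (not necessarily unital), $\delta:A\to A\otimes A$ is a linear map that is coassociative, $(\delta\otimes\mathrm{id})\delta=(\mathrm{id}\otimes\delta)\delta$, and cocommutative, $\tau\delta=\delta$, and $D,Q:A\to A$ are linear maps, such that for all $a,b\in A$, with $L(a)b=a\cdot b$ and $R(a)b=b\cdot a$, $$\delta(a\cdot b)=(\mathrm{id}\otimes L(a))\delta(b)+(R(b)\otimes\mathrm{id})\delta(a),$$ $$(L(b)\otimes\mathrm{id}-\mathrm{id}\otimes R(b))\delta(a)+\tau\big((L(a)\otimes\mathrm{id}-\mathrm{id}\otimes R(a))\delta(b)\big)=0,$$ $$D(a\cdot b)=D(a)\cdot b+a\cdot D(b),\qquad Q(a\cdot b)=Q(a)\cdot b-a\cdot D(b),$$ $$\delta(Q(a))=(\mathrm{id}\otimes Q+Q\otimes\mathrm{id})\delta(a),\qquad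 (D\otimes\mathrm{id}-\mathrm{id}\otimes Q)\delta(a)=\delta(D(a)).$$ For a $\mathbb{Z}$-graded vector space $L=\bigoplus_{i\in\mathbb{Z}}L_i$ with all $L_i$ finite-dimensional, let $L\widehat\otimes L=\prod_{i,j\in\mathbb{Z}}L_i\otimes L_j$ and $L\widehat\otimes L\widehat\otimes L=\prod_{i,j,l\in\mathbb{Z}}L_i\otimes L_j\otimes L_l$, let $\widehat\tau$ be the flip of $L\widehat\otimes L$, and let $f\widehat\otimes g$ be given by $\sum c_i\otimes d_j\mapsto\sum f(c_i)\otimes g(d_j)$ whenever $f$ and $g$ are locally finite, i.e. each homogeneous component of $f$ (of $g$) is nonzero on only finitely many $L_i$. A completed Lie bialgebra is a triple $(L,[\cdot,\cdot],\Delta)$ where $L$ is such a graded space, $(L,[\cdot,\cdot])$ is a Lie algebra, and $\Delta:L\to L\widehat\otimes L$ is a linear map, such that $\Delta$ and all maps $\mathrm{ad}_x=[x,\cdot]$ are locally finite and, for all $x,y\in L$, $$\Delta(x)=-\widehat\tau\Delta(x),\qquad (\mathrm{id}\widehat\otimes\Delta)\Delta(x)-(\widehat\tau\widehat\otimes\mathrm{id})(\mathrm{id}\widehat\otimes\Delta)\Delta(x)=(\Delta\widehat\otimes\mathrm{id})\Delta(x),$$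 $$\Delta([x,y])=(\mathrm{ad}_x\widehat\otimes\mathrm{id}+\mathrm{id}\widehat\otimes\mathrm{ad}_x)\Delta(y)-(\mathrm{ad}_y\widehat\otimes\mathrm{id}+\mathrm{id}\widehat\otimes\mathrm{ad}_y)\Delta(x).$$ Let $L=A\otimes\mathbf{k}[t,t^{-1}]$, graded by $L_i=A\otimes t^i$, and write $at^m=a\otimes t^m$. For $q\in\mathbf{k}$, let $[\cdot,\cdot]_q$ be the bilinear operation on $L$ and $\delta_{L,q}:L\to L\widehat\otimes L$ the linear map with $$[at^m,bt^n]_q=m\,(a\cdot(D+qQ)(b))\,t^{m+n-1}-n\,(b\cdot(D+qQ)(a))\,t^{m+n-1},$$ $$\delta_{L,q}(at^m)=\sum_{i\in\mathbb{Z}}\sum(i+1)\big(a_{(1)}t^{-i-2}\otimes(Q+qD)(a_{(2)})\,t^{m+i}-(Q+qD)(a_{(2)})\,t^{m+i}\otimes a_{(1)}t^{-i-2}\big)$$ for all $a,b\in A$ and $m,n\in\mathbb{Z}$, where $\delta(a)=\sum a_{(1)}\otimes a_{(2)}$. Then: 1. $(L,[\cdot,\cdot]_{-1/2},\delta_{L,-1/2})$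 is a completed Lie bialgebra. 2. If $a\cdot Q(b)=-a\cdot D(b)$ for all $a,b\in A$ and $(\mathrm{id}\otimes Q)\delta=-(\mathrm{id}\otimes D)\delta$, then $(L,[\cdot,\cdot]_q,\delta_{L,q})$ is a completed Lie bialgebra for every $q\in\mathbf{k}$. -/

import Mathlib

open scoped TensorProduct DirectSum LaurentPolynomial

noncomputable section

namespace CompletedLie

/-! ### Commutative and cocommutative differential ASI bialgebras

The algebra `A` is a commutative associative algebra over `k`, not assumed unital; the
coproduct `δ` is not assumed counital. -/

section Bialgebra

variable {k A : Type*} [Field k] [NonUnitalCommRing A] [Module k A] [IsScalarTower k A A]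
  [SMulCommClass k A A]

/-- `(A, δ)` is a coassociative coalgebra. -/
def IsCoassociative (δ : A →ₗ[k] A ⊗[k] A) : Prop :=
  (TensorProduct.assoc k A A A).toLinearMap ∘ₗ δ.rTensor A ∘ₗ δ = δ.lTensor A ∘ₗ δ

/-- `δ = τ δ`. -/
def IsCocommutative (δ : A →ₗ[k] A ⊗[k] A) : Prop :=
  ∀ a, δ a = TensorProduct.comm k A A (δ a)

/-- `(A, ·, δ)` is an antisymmetric infinitesimal bialgebra. The second compatibility
condition is automatic here, since `A` is commutative and `δ` will be cocommutative. -/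
structure IsASIBialgebra (δ : A →ₗ[k] A ⊗[k] A) : Prop where
  coassoc : IsCoassociative δ
  map_mul : ∀ a b, δ (a * b) =
    (LinearMap.mulLeft k a).lTensor A (δ b) + (LinearMap.mulRight k b).rTensor A (δ a)
  antisymm : ∀ a b,
    ((LinearMap.mulLeft k b).rTensor A (δ a) - (LinearMap.mulRight k b).lTensor A (δ a)) +
      TensorProduct.comm k A A
        ((LinearMap.mulLeft k a).rTensor A (δ b) - (LinearMap.mulRight k a).lTensor A (δ b)) = 0

/-- `(A, ·, D, Q)` is an admissible commutative differential algebra. -/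
structure IsAdmissibleDiffAlgebra (D Q : A →ₗ[k] A) : Prop where
  leibniz : ∀ a b, D (a * b) = D a * b + a * D b
  admissible : ∀ a b, Q (a * b) = Q a * b - a * D b

/-- `(A, δ, Q, D)` is an admissible cocommutative differential coalgebra. -/
structure IsAdmissibleDiffCoalgebra (δ : A →ₗ[k] A ⊗[k] A) (Q D : A →ₗ[k] A) : Prop where
  coassoc : IsCoassociative δ
  cocomm : IsCocommutative δ
  coderivation : ∀ a, δ (Q a) = Q.lTensor A (δ a) + Q.rTensor A (δ a)
  admissible : ∀ a, D.rTensor A (δ a) - Q.lTensor A (δ a) = δ (D a)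

/-- `(A, ·, δ, D, Q)` is a commutative and cocommutative differential ASI bialgebra. -/
structure IsDiffASIBialgebra (δ : A →ₗ[k] A ⊗[k] A) (D Q : A →ₗ[k] A) : Prop where
  asi : IsASIBialgebra δ
  algebra : IsAdmissibleDiffAlgebra D Q
  coalgebra : IsAdmissibleDiffCoalgebra δ Q D

end Bialgebra

/-! ### Completed Lie bialgebras

A `ℤ`-graded vector space is a vector space `L` with an isomorphism `gr : L ≃ₗ[k] ⨁ i, V i`. -/

section Completed

variable {k : Type*} [Field k] {V : ℤ → Type*} [∀ i, AddCommGroup (V i)] [∀ i, Module k (V i)]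
  {L : Type*} [AddCommGroup L] [Module k L]

variable (k V) in
/-- The completed tensor product `L ⊗̂ L = ∏_{i, j} L_i ⊗ L_j`. -/
abbrev CTensor : Type _ := ∀ p : ℤ × ℤ, V p.1 ⊗[k] V p.2

variable (k V) in
/-- The triple completed tensor product `∏_{i, j, l} L_i ⊗ (L_j ⊗ L_l)`. -/
abbrev CTensor₃ : Type _ := ∀ p : ℤ × ℤ × ℤ, V p.1 ⊗[k] (V p.2.1 ⊗[k] V p.2.2)

/-- The inclusion of `L = ⨁ L_i` in `∏ L_i`. -/
def coords (gr : L ≃ₗ[k] ⨁ i, V i) : L →ₗ[k] ∀ i, V i :=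
  LinearMap.pi fun i => DirectSum.component k ℤ V i ∘ₗ gr.toLinearMap

/-- The block `L_i → U_α` of a linear map `L → ∏_α U_α`. -/
def block (gr : L ≃ₗ[k] ⨁ i, V i) {α : Type*} {U : α → Type*} [∀ a, AddCommGroup (U a)]
    [∀ a, Module k (U a)] (F : L →ₗ[k] ∀ a, U a) (i : ℤ) (a : α) : V i →ₗ[k] U a :=
  LinearMap.proj a ∘ₗ F ∘ₗ gr.symm.toLinearMap ∘ₗ DirectSum.lof k ℤ V i

/-- Every component of `F : L → ∏_α U_α` involves only finitely many degrees of `L`. This is what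
makes the infinite sums in `F ⊗̂ G` finite in each component. -/
def IsLocallyFinite (gr : L ≃ₗ[k] ⨁ i, V i) {α : Type*} {U : α → Type*}
    [∀ a, AddCommGroup (U a)] [∀ a, Module k (U a)] (F : L →ₗ[k] ∀ a, U a) : Prop :=
  ∀ a, {i : ℤ | block gr F i a ≠ 0}.Finite

/-- `F ⊗̂ G : L ⊗̂ L → ∏_{α, β} U_α ⊗ W_β`, `∑ c_i ⊗ d_j ↦ ∑ F(c_i) ⊗ G(d_j)`, for linear maps
`F : L → ∏_α U_α` and `G : L → ∏_β W_β`. Each component is a finite sum when `F` and `G` are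
locally finite; it is only used for such maps. -/
def hatMap (gr : L ≃ₗ[k] ⨁ i, V i) {α β : Type*} {U : α → Type*} {W : β → Type*}
    [∀ a, AddCommGroup (U a)] [∀ a, Module k (U a)]
    [∀ b, AddCommGroup (W b)] [∀ b, Module k (W b)]
    (F : L →ₗ[k] ∀ a, U a) (G : L →ₗ[k] ∀ b, W b) (x : CTensor k V) :
    ∀ p : α × β, U p.1 ⊗[k] W p.2 :=
  fun p => ∑ᶠ ij : ℤ × ℤ,
    TensorProduct.map (block gr F ij.1 p.1) (block gr G ij.2 p.2) (x ij)

/-- The completed flip `τ̂` on `L ⊗̂ L`. -/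
def hatFlip (x : CTensor k V) : CTensor k V :=
  fun p => TensorProduct.comm k (V p.2) (V p.1) (x (p.2, p.1))

/-- `τ̂ ⊗̂ id` on the triple completed tensor product. -/
def hatFlip₃ (x : CTensor₃ k V) : CTensor₃ k V :=
  fun p => TensorProduct.leftComm k (V p.2.1) (V p.1) (V p.2.2) (x (p.2.1, p.1, p.2.2))

/-- The identification `(L ⊗̂ L) ⊗̂ L = L ⊗̂ (L ⊗̂ L)`. -/
def hatAssoc (x : ∀ p : (ℤ × ℤ) × ℤ, (V p.1.1 ⊗[k] V p.1.2) ⊗[k] V p.2) : CTensor₃ k V :=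
  fun p => TensorProduct.assoc k (V p.1) (V p.2.1) (V p.2.2) (x ((p.1, p.2.1), p.2.2))

/-- The bilinear operation `br` makes `L` a Lie algebra. -/
structure IsLieBracket (br : L →ₗ[k] L →ₗ[k] L) : Prop where
  self : ∀ x, br x x = 0
  jacobi : ∀ x y z, br x (br y z) + br y (br z x) + br z (br x y) = 0

/-- `(L, δ)` is a completed Lie coalgebra. -/
structure IsCompletedLieCoalgebra (gr : L ≃ₗ[k] ⨁ i, V i) (δ : L →ₗ[k] CTensor k V) : Prop where
  finite : ∀ i, Module.Finite k (V i)
  locallyFinite : IsLocallyFinite gr δ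
  antisymm : ∀ a, δ a = -hatFlip (δ a)
  cojacobi : ∀ a,
    hatMap gr (coords gr) δ (δ a) - hatFlip₃ (hatMap gr (coords gr) δ (δ a)) =
      hatAssoc (hatMap gr δ (coords gr) (δ a))

/-- `(ad_a ⊗̂ id + id ⊗̂ ad_a) x`. -/
def hatAd (gr : L ≃ₗ[k] ⨁ i, V i) (br : L →ₗ[k] L →ₗ[k] L) (a : L) (x : CTensor k V) :
    CTensor k V :=
  hatMap gr (coords gr ∘ₗ br a) (coords gr) x + hatMap gr (coords gr) (coords gr ∘ₗ br a) x

/-- `(L, br, δ)` is a completed Lie bialgebra. -/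
structure IsCompletedLieBialgebra (gr : L ≃ₗ[k] ⨁ i, V i) (br : L →ₗ[k] L →ₗ[k] L)
    (δ : L →ₗ[k] CTensor k V) : Prop where
  lie : IsLieBracket br
  coalgebra : IsCompletedLieCoalgebra gr δ
  ad_locallyFinite : ∀ a, IsLocallyFinite gr (coords gr ∘ₗ br a)
  compatible : ∀ a b, δ (br a b) = hatAd gr br a (δ b) - hatAd gr br b (δ a)

end Completed

/-! ### The bracket and the cobracket on `A ⊗ k[t, t⁻¹]` -/

section Laurent

variable {k A : Type*} [Field k] [AddCommGroup A] [Module k A]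

variable (k A) in
/-- `a ↦ a t^m`. -/
def mono (m : ℤ) : A →ₗ[k] A ⊗[k] k[T;T⁻¹] :=
  (TensorProduct.mk k A k[T;T⁻¹]).flip (LaurentPolynomial.T m)

variable (k A) in
/-- The grading of `A ⊗ k[t, t⁻¹]` with `A t^i` in degree `i`; the piece `A t^i` is identified
with `A`. -/
def grading : A ⊗[k] k[T;T⁻¹] ≃ₗ[k] ⨁ _ : ℤ, A :=
  TensorProduct.congr (LinearEquiv.refl k A) (AddMonoidAlgebra.coeffLinearEquiv k) ≪≫ₗ
    TensorProduct.finsuppScalarRight k k A ℤ ≪≫ₗ finsuppLEquivDirectSum k A ℤ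

theorem grading_mono (m : ℤ) (a : A) :
    grading k A (mono k A m a) = DirectSum.lof k ℤ (fun _ => A) m a := by
  simp only [grading, mono, LinearMap.flip_apply, TensorProduct.mk_apply, LinearEquiv.trans_apply,
    TensorProduct.congr_tmul, LinearEquiv.refl_apply]
  have : AddMonoidAlgebra.coeffLinearEquiv k (LaurentPolynomial.T m : k[T;T⁻¹]) =
      Finsupp.single m (1 : k) := rfl
  rw [this, TensorProduct.finsuppScalarRight_apply_tmul]
  simp [finsuppLEquivDirectSum_single]

end Laurent

section Construction

variable {k A : Type*} [Field k] [NonUnitalCommRing A] [Module k A] [IsScalarTower k A A]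
  [SMulCommClass k A A]

/-- The operation `a ∘_q b = a · (D + q Q) b`. -/
def circ (D Q : A →ₗ[k] A) (q : k) : A →ₗ[k] A →ₗ[k] A :=
  (LinearMap.mul k A).compl₂ (D + q • Q)

/-- The bracket on homogeneous elements,
`(a, b) ↦ m (a · (D + qQ) b) t^(m+n-1) - n (b · (D + qQ) a) t^(m+n-1)`. -/
def bracketAt (D Q : A →ₗ[k] A) (q : k) (m n : ℤ) : A →ₗ[k] A →ₗ[k] A ⊗[k] k[T;T⁻¹] :=
  (m : k) • (circ D Q q).compr₂ (mono k A (m + n - 1)) -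
    (n : k) • (circ D Q q).flip.compr₂ (mono k A (m + n - 1))

/-- The bilinear operation `[·,·]_q` on `A ⊗ k[t, t⁻¹]`. -/
def bracket (D Q : A →ₗ[k] A) (q : k) :
    A ⊗[k] k[T;T⁻¹] →ₗ[k] A ⊗[k] k[T;T⁻¹] →ₗ[k] A ⊗[k] k[T;T⁻¹] :=
  (DirectSum.toModule k ℤ _ fun m => LinearMap.flip
    (DirectSum.toModule k ℤ _ fun n => (bracketAt D Q q m n).flip)).compl₁₂
    (grading k A).toLinearMap (grading k A).toLinearMap

theorem bracket_mono (D Q : A →ₗ[k] A) (q : k) (m n : ℤ) (a b : A) :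
    bracket D Q q (mono k A m a) (mono k A n b) =
      (m : k) • mono k A (m + n - 1) (a * (D b + q • Q b)) -
        (n : k) • mono k A (m + n - 1) (b * (D a + q • Q a)) := by
  simp [bracket, grading_mono, bracketAt, circ]

end Construction

section Cobracket

variable {k A : Type*} [Field k] [AddCommGroup A] [Module k A]

variable (k A) in
/-- The inclusion of `A t^i ⊗ A t^j` in the completed tensor product. -/
def incl (i j : ℤ) : A ⊗[k] A →ₗ[k] CTensor k fun _ => A :=
  LinearMap.single k (fun _ : ℤ × ℤ => A ⊗[k] A) (i, j)

/-- `Δ_q = (id ⊗ (Q + q D)) δ`. -/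
def coprod (δ : A →ₗ[k] A ⊗[k] A) (D Q : A →ₗ[k] A) (q : k) : A →ₗ[k] A ⊗[k] A :=
  (Q + q • D).lTensor A ∘ₗ δ

/-- The `i`-th term of the formal sum that defines the cobracket of `a t^m`:
`(i + 1) (a₁ t^(-i-2) ⊗ (Q + qD) a₂ t^(m+i) - (Q + qD) a₂ t^(m+i) ⊗ a₁ t^(-i-2))`. -/
def cobracketTerm (δ : A →ₗ[k] A ⊗[k] A) (D Q : A →ₗ[k] A) (q : k) (m i : ℤ) :
    A →ₗ[k] CTensor k fun _ => A :=
  ((i : k) + 1) • (incl k A (-i - 2) (m + i) ∘ₗ coprod δ D Q q -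
    incl k A (m + i) (-i - 2) ∘ₗ (TensorProduct.comm k A A).toLinearMap ∘ₗ coprod δ D Q q)

/-- The formal sum `∑_{i ∈ ℤ}` of the terms `cobracketTerm`, taken in each component, where only
finitely many terms are nonzero. -/
def cobracketAt (δ : A →ₗ[k] A ⊗[k] A) (D Q : A →ₗ[k] A) (q : k) (m : ℤ) :
    A →ₗ[k] CTensor k fun _ => A :=
  LinearMap.pi fun p => ∑ᶠ i : ℤ, LinearMap.proj p ∘ₗ cobracketTerm δ D Q q m i

/-- The cobracket `δ_{L,q} : L → L ⊗̂ L` on `L = A ⊗ k[t, t⁻¹]`. -/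
def cobracket (δ : A →ₗ[k] A ⊗[k] A) (D Q : A →ₗ[k] A) (q : k) :
    A ⊗[k] k[T;T⁻¹] →ₗ[k] CTensor k fun _ => A :=
  DirectSum.toModule k ℤ _ (cobracketAt δ D Q q) ∘ₗ (grading k A).toLinearMap

/-- The components of the cobracket in closed form. -/
theorem cobracket_mono (δ : A →ₗ[k] A ⊗[k] A) (D Q : A →ₗ[k] A) (q : k) (m r s : ℤ) (a : A) :
    cobracket δ D Q q (mono k A m a) (r, s) =
      if r + s = m - 2 then
        ((s : k) + 1) • TensorProduct.comm k A A (coprod δ D Q q a) -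
          ((r : k) + 1) • coprod δ D Q q a
      else 0 := by
  have hc : cobracket δ D Q q (mono k A m a) = cobracketAt δ D Q q m a := by
    simp [cobracket, grading_mono]
  have hfin : (Function.support fun i : ℤ =>
      LinearMap.proj (R := k) (φ := fun _ : ℤ × ℤ => A ⊗[k] A) (r, s) ∘ₗ
        cobracketTerm δ D Q q m i) ⊆ (({-r - 2, -s - 2} : Finset ℤ) : Set ℤ) := by
    intro i hi
    by_contra hn
    simp only [Finset.coe_insert, Finset.coe_singleton, Set.mem_insert_iff,
      Set.mem_singleton_iff, not_or] at hn
    refine hi (LinearMap.ext fun x => ?_)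
    have h1 : ((r, s) : ℤ × ℤ) ≠ (-i - 2, m + i) := by
      intro h; have := congrArg Prod.fst h; simp only at this; omega
    have h2 : ((r, s) : ℤ × ℤ) ≠ (m + i, -i - 2) := by
      intro h; have := congrArg Prod.snd h; simp only at this; omega
    simp [cobracketTerm, incl, Pi.single_eq_of_ne h1, Pi.single_eq_of_ne h2]
  rw [hc]
  simp only [cobracketAt, LinearMap.pi_apply]
  rw [finsum_eq_sum_of_support_subset _ hfin]
  simp only [LinearMap.sum_apply, LinearMap.comp_apply, LinearMap.proj_apply, cobracketTerm, incl,
    LinearMap.smul_apply, LinearMap.sub_apply, LinearMap.single_apply, Pi.smul_apply, Pi.sub_apply,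
    Pi.single_apply, Prod.mk.injEq, LinearEquiv.coe_coe]
  by_cases h : r + s = m - 2
  · rw [if_pos h]
    by_cases hrs : r = s
    · subst hrs
      have h1 : r = -(-r - 2) - 2 := by omega
      have h2 : r = m + (-r - 2) := by omega
      rw [Finset.pair_eq_singleton, Finset.sum_singleton, if_pos ⟨h1, h2⟩, if_pos ⟨h2, h1⟩]
      push_cast
      module
    · have a1 : r = -(-r - 2) - 2 ∧ s = m + (-r - 2) := by omega
      have a2 : ¬ (r = m + (-r - 2) ∧ s = -(-r - 2) - 2) := by omega
      have a3 : ¬ (r = -(-s - 2) - 2 ∧ s = m + (-s - 2)) := by omega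
      have a4 : r = m + (-s - 2) ∧ s = -(-s - 2) - 2 := by omega
      rw [Finset.sum_pair (by omega), if_pos a1, if_neg a2, if_neg a3, if_pos a4]
      push_cast
      module
  · rw [if_neg h]
    refine Finset.sum_eq_zero fun i _ => ?_
    rw [if_neg (by omega), if_neg (by omega)]
    simp

end Cobracket

end CompletedLie

end

noncomputable section

namespace CompletedLie

/-! ### Componentwise computation of `F ⊗̂ G` -/

section HatMap

variable {k : Type*} [Field k] {V : ℤ → Type*} [∀ i, AddCommGroup (V i)] [∀ i, Module k (V i)]
  {L : Type*} [AddCommGroup L] [Module k L] {gr : L ≃ₗ[k] ⨁ i, V i} {α β : Type*}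
  {U : α → Type*} {W : β → Type*} [∀ a, AddCommGroup (U a)] [∀ a, Module k (U a)]
  [∀ b, AddCommGroup (W b)] [∀ b, Module k (W b)]

/-! Put `E = D + Q`. Adding the rules for `D` and `Q` shows that `E` is linear over `A`
(`centroid_mul`) and colinear for `δ` (`map_centroid`, `lTensor_centroid`), while `D` is a
derivation and satisfies `δ D = (D ⊗ id + id ⊗ D - E ⊗ id) δ`. The twisted operators become `D + qQ
= (1-q)D + qE` and `Q + qD = E - (1-q)D`.

The bracket lowers total degree by 1 and the cobracket by 2, so on monomials each component of a
completed identity has only finitely many terms. It is an identity in `A ⊗ A` or `A ⊗ A ⊗ A` whose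
coefficients are polynomials in the degrees.

Jacobi (`bracket_jacobi`) and co-Jacobi (`cobracketBlock_cojacobi`) hold for every `q`. The value of
`q` matters only for compatibility (`cobracketBlock_compatible`), which follows from `δ(ab) = δ(ba)`
and from `commutator_exchange` when `q = -1/2`, and from the former alone when `E = 0`. The second
assertion reduces to `E = 0`: under its hypotheses `Q` can be replaced by `-D` without changing the
bracket or the cobracket. -/

theorem block_add (F F' : L →ₗ[k] ∀ a, U a) (i : ℤ) (a : α) :
    block gr (F + F') i a = block gr F i a + block gr F' i a := rfl

theorem block_zero (i : ℤ) (a : α) : block gr (0 : L →ₗ[k] ∀ a, U a) i a = 0 := rfl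

theorem IsLocallyFinite.add {F F' : L →ₗ[k] ∀ a, U a} (hF : IsLocallyFinite gr F)
    (hF' : IsLocallyFinite gr F') : IsLocallyFinite gr (F + F') := by
  intro a
  refine ((hF a).union (hF' a)).subset fun i hi => ?_
  by_contra hn
  simp only [Set.mem_union, Set.mem_ofPred_eq, not_or, not_not] at hn
  exact hi (by rw [block_add, hn.1, hn.2, add_zero])

theorem IsLocallyFinite.zero : IsLocallyFinite gr (0 : L →ₗ[k] ∀ a, U a) := by
  intro a
  simp [block_zero]

theorem isLocallyFinite_of_forall_ne {F : L →ₗ[k] ∀ a, U a} (f : α → ℤ)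
    (h : ∀ a i, i ≠ f a → block gr F i a = 0) : IsLocallyFinite gr F := fun a =>
  (Set.finite_singleton (f a)).subset fun i hi => by
    by_contra hn
    exact hi (h a i hn)

/-- A `finsum` with infinite support takes the default value 0, so the additivity of `hatMap` rests
on this finiteness. -/
theorem hatMap_support_finite {F : L →ₗ[k] ∀ a, U a} {G : L →ₗ[k] ∀ b, W b}
    (hF : IsLocallyFinite gr F) (hG : IsLocallyFinite gr G) (x : CTensor k V) (p : α × β) :
    (Function.support fun ij : ℤ × ℤ =>
      TensorProduct.map (block gr F ij.1 p.1) (block gr G ij.2 p.2) (x ij)).Finite := by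
  refine ((hF p.1).prod (hG p.2)).subset fun ij hij => ?_
  refine ⟨fun h => hij ?_, fun h => hij ?_⟩
  · simp [h]
  · simp [h]

theorem hatMap_zero (F : L →ₗ[k] ∀ a, U a) (G : L →ₗ[k] ∀ b, W b) :
    hatMap gr F G (0 : CTensor k V) = 0 := by
  funext p
  simp [hatMap]

theorem hatMap_add {F : L →ₗ[k] ∀ a, U a} {G : L →ₗ[k] ∀ b, W b}
    (hF : IsLocallyFinite gr F) (hG : IsLocallyFinite gr G) (x y : CTensor k V) :
    hatMap gr F G (x + y) = hatMap gr F G x + hatMap gr F G y := by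
  funext p
  simp only [hatMap, Pi.add_apply, map_add]
  exact finsum_add_distrib (hatMap_support_finite hF hG x p) (hatMap_support_finite hF hG y p)

theorem hatMap_zero_left (G : L →ₗ[k] ∀ b, W b) (x : CTensor k V) :
    hatMap gr (0 : L →ₗ[k] ∀ a, U a) G x = 0 := by
  funext p
  simp [hatMap, block_zero]

theorem hatMap_zero_right (F : L →ₗ[k] ∀ a, U a) (x : CTensor k V) :
    hatMap gr F (0 : L →ₗ[k] ∀ b, W b) x = 0 := by
  funext p
  simp [hatMap, block_zero]

theorem hatMap_add_left {F F' : L →ₗ[k] ∀ a, U a} {G : L →ₗ[k] ∀ b, W b}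
    (hF : IsLocallyFinite gr F) (hF' : IsLocallyFinite gr F') (hG : IsLocallyFinite gr G)
    (x : CTensor k V) : hatMap gr (F + F') G x = hatMap gr F G x + hatMap gr F' G x := by
  funext p
  simp only [hatMap, Pi.add_apply, block_add, TensorProduct.map_add_left, LinearMap.add_apply]
  exact finsum_add_distrib (hatMap_support_finite hF hG x p) (hatMap_support_finite hF' hG x p)

theorem hatMap_add_right {F : L →ₗ[k] ∀ a, U a} {G G' : L →ₗ[k] ∀ b, W b}
    (hF : IsLocallyFinite gr F) (hG : IsLocallyFinite gr G) (hG' : IsLocallyFinite gr G')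
    (x : CTensor k V) : hatMap gr F (G + G') x = hatMap gr F G x + hatMap gr F G' x := by
  funext p
  simp only [hatMap, Pi.add_apply, block_add, TensorProduct.map_add_right, LinearMap.add_apply]
  exact finsum_add_distrib (hatMap_support_finite hF hG x p) (hatMap_support_finite hF hG' x p)

/-- If the blocks of `F` and `G` into the component `p` come from single degrees `i` and `j`, the
sum defining `(F ⊗̂ G) x` in the component `p` has one term. -/
theorem hatMap_apply_eq (F : L →ₗ[k] ∀ a, U a) (G : L →ₗ[k] ∀ b, W b) (x : CTensor k V)
    (p : α × β) (i j : ℤ) (hF : ∀ i', i' ≠ i → block gr F i' p.1 = 0)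
    (hG : ∀ j', j' ≠ j → block gr G j' p.2 = 0) :
    hatMap gr F G x p = TensorProduct.map (block gr F i p.1) (block gr G j p.2) (x (i, j)) := by
  refine finsum_eq_single (f := fun ij : ℤ × ℤ =>
    TensorProduct.map (block gr F ij.1 p.1) (block gr G ij.2 p.2) (x ij)) (i, j) fun ij hij => ?_
  by_cases h : ij.1 = i
  · have h' : ij.2 ≠ j := fun h' => hij (Prod.ext h h')
    simp [hG _ h']
  · simp [hF _ h]

end HatMap

/-! ### Blocks of the structure maps of `A ⊗ k[t, t⁻¹]` -/

section Blocks

variable {k A : Type*} [Field k] [AddCommGroup A] [Module k A]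

/-- Direct sum induction transported along the grading; it reduces the additive identities below to
monomials. -/
theorem laurent_induction {motive : A ⊗[k] k[T;T⁻¹] → Prop} (x : A ⊗[k] k[T;T⁻¹])
    (zero : motive 0) (mono : ∀ m a, motive (mono k A m a))
    (add : ∀ x y, motive x → motive y → motive (x + y)) : motive x := by
  have key : ∀ y : ⨁ _ : ℤ, A, motive ((grading k A).symm y) := by
    intro y
    induction y using DirectSum.induction_on with
    | zero => simpa using zero
    | of m a =>
      have : (grading k A).symm (DirectSum.lof k ℤ (fun _ => A) m a) = CompletedLie.mono k A m a := by
        rw [← grading_mono, LinearEquiv.symm_apply_apply]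
      exact this ▸ mono m a
    | add x y hx hy => simpa using add _ _ hx hy
  simpa using key (grading k A x)

theorem block_grading_apply {α : Type*} {U : α → Type*} [∀ a, AddCommGroup (U a)]
    [∀ a, Module k (U a)] (F : A ⊗[k] k[T;T⁻¹] →ₗ[k] ∀ a, U a) (i : ℤ) (a : α) (x : A) :
    block (grading k A) F i a x = F (mono k A i x) a := by
  have : (grading k A).symm (DirectSum.lof k ℤ (fun _ => A) i x) = mono k A i x := by
    rw [← grading_mono, LinearEquiv.symm_apply_apply]
  simp [block, this]

theorem coords_mono (m i : ℤ) (a : A) :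
    coords (grading k A) (mono k A m a) i = if m = i then a else 0 := by
  simp only [coords, LinearMap.pi_apply, LinearMap.comp_apply, LinearEquiv.coe_coe, grading_mono]
  rw [DirectSum.component.of]
  split_ifs with h
  · subst h; rfl
  · rfl

theorem block_coords_self (i : ℤ) :
    block (grading k A) (coords (grading k A)) i i = LinearMap.id := by
  ext x
  simp [block_grading_apply, coords_mono]

theorem block_coords_of_ne {i j : ℤ} (h : i ≠ j) :
    block (grading k A) (coords (grading k A)) i j = 0 := by
  ext x
  simp [block_grading_apply, coords_mono, h]

theorem isLocallyFinite_coords : IsLocallyFinite (grading k A) (coords (grading k A)) :=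
  isLocallyFinite_of_forall_ne (fun a => a) fun _ _ h => block_coords_of_ne h

/-- The component `A t^(r+s+2) → A t^r ⊗ A t^s` of the cobracket. -/
def cobracketBlock (δ : A →ₗ[k] A ⊗[k] A) (D Q : A →ₗ[k] A) (q : k) (r s : ℤ) :
    A →ₗ[k] A ⊗[k] A :=
  ((s : k) + 1) • (TensorProduct.comm k A A).toLinearMap ∘ₗ coprod δ D Q q -
    ((r : k) + 1) • coprod δ D Q q

theorem block_cobracket (δ : A →ₗ[k] A ⊗[k] A) (D Q : A →ₗ[k] A) (q : k) (r s i : ℤ)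
    (h : i = r + s + 2) :
    block (grading k A) (cobracket δ D Q q) i (r, s) = cobracketBlock δ D Q q r s := by
  ext x
  rw [block_grading_apply, cobracket_mono, if_pos (by omega)]
  rfl

theorem block_cobracket_of_ne (δ : A →ₗ[k] A ⊗[k] A) (D Q : A →ₗ[k] A) (q : k) (p : ℤ × ℤ)
    (i : ℤ) (h : i ≠ p.1 + p.2 + 2) :
    block (grading k A) (cobracket δ D Q q) i p = 0 := by
  ext x
  rw [block_grading_apply, cobracket_mono, if_neg (by omega)]
  rfl

theorem cobracket_mono_eq (δ : A →ₗ[k] A ⊗[k] A) (D Q : A →ₗ[k] A) (q : k) (m r s : ℤ) (a : A) :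
    cobracket δ D Q q (mono k A m a) (r, s) =
      if r + s = m - 2 then cobracketBlock δ D Q q r s a else 0 :=
  cobracket_mono δ D Q q m r s a

theorem isLocallyFinite_cobracket (δ : A →ₗ[k] A ⊗[k] A) (D Q : A →ₗ[k] A) (q : k) :
    IsLocallyFinite (grading k A) (cobracket δ D Q q) :=
  isLocallyFinite_of_forall_ne (fun p => p.1 + p.2 + 2) fun p i h =>
    block_cobracket_of_ne δ D Q q p i h

theorem hatMap_coords_cobracket_apply (δ : A →ₗ[k] A ⊗[k] A) (D Q : A →ₗ[k] A) (q : k)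
    (x : CTensor k fun _ => A) (r s u : ℤ) :
    hatMap (grading k A) (coords (grading k A)) (cobracket δ D Q q) x (r, s, u) =
      (cobracketBlock δ D Q q s u).lTensor A (x (r, s + u + 2)) := by
  rw [hatMap_apply_eq _ _ x (r, s, u) r (s + u + 2) (fun i h => block_coords_of_ne h)
    (fun j h => block_cobracket_of_ne δ D Q q _ j h), block_coords_self,
    block_cobracket δ D Q q s u _ rfl]
  rfl

theorem hatMap_cobracket_coords_apply (δ : A →ₗ[k] A ⊗[k] A) (D Q : A →ₗ[k] A) (q : k)
    (x : CTensor k fun _ => A) (r s u : ℤ) :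
    hatMap (grading k A) (cobracket δ D Q q) (coords (grading k A)) x ((r, s), u) =
      (cobracketBlock δ D Q q r s).rTensor A (x (r + s + 2, u)) := by
  rw [hatMap_apply_eq _ _ x ((r, s), u) (r + s + 2) u
    (fun j h => block_cobracket_of_ne δ D Q q _ j h) (fun i h => block_coords_of_ne h),
    block_coords_self, block_cobracket δ D Q q r s _ rfl]
  rfl

end Blocks

/-! ### Blocks of the adjoint maps -/

section AdBlocks

variable {k A : Type*} [Field k] [NonUnitalCommRing A] [Module k A] [IsScalarTower k A A]
  [SMulCommClass k A A]

/-- The component `A t^i → A t^(m+i-1)` of `ad (a t^m)`. -/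
def adBlock (D Q : A →ₗ[k] A) (q : k) (m i : ℤ) (a : A) : A →ₗ[k] A :=
  (m : k) • (LinearMap.mulLeft k a ∘ₗ (D + q • Q)) - (i : k) • LinearMap.mulLeft k (D a + q • Q a)

theorem coords_bracket_mono (D Q : A →ₗ[k] A) (q : k) (m i r : ℤ) (a x : A) :
    coords (grading k A) (bracket D Q q (mono k A m a) (mono k A i x)) r =
      if m + i - 1 = r then adBlock D Q q m i a x else 0 := by
  rw [bracket_mono]
  simp only [map_sub, map_smul, Pi.sub_apply, Pi.smul_apply, coords_mono, adBlock,
    LinearMap.sub_apply, LinearMap.smul_apply, LinearMap.comp_apply, LinearMap.mulLeft_apply,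
    LinearMap.add_apply]
  split_ifs
  · rw [mul_comm x]
  · simp

theorem block_ad (D Q : A →ₗ[k] A) (q : k) (m i r : ℤ) (a : A) (h : i = r - m + 1) :
    block (grading k A) (coords (grading k A) ∘ₗ bracket D Q q (mono k A m a)) i r =
      adBlock D Q q m i a := by
  ext x
  rw [block_grading_apply, LinearMap.comp_apply, coords_bracket_mono, if_pos (by omega)]

theorem block_ad_of_ne (D Q : A →ₗ[k] A) (q : k) (m i r : ℤ) (a : A) (h : i ≠ r - m + 1) :
    block (grading k A) (coords (grading k A) ∘ₗ bracket D Q q (mono k A m a)) i r = 0 := by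
  ext x
  rw [block_grading_apply, LinearMap.comp_apply, coords_bracket_mono, if_neg (by omega)]
  rfl

theorem isLocallyFinite_ad (D Q : A →ₗ[k] A) (q : k) (x : A ⊗[k] k[T;T⁻¹]) :
    IsLocallyFinite (grading k A) (coords (grading k A) ∘ₗ bracket D Q q x) := by
  induction x using laurent_induction with
  | zero =>
    rw [map_zero, LinearMap.comp_zero]
    exact IsLocallyFinite.zero
  | mono m a =>
    exact isLocallyFinite_of_forall_ne (fun r => r - m + 1) fun r i h =>
      block_ad_of_ne D Q q m i r a h
  | add x y hx hy =>
    rw [map_add, LinearMap.comp_add]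
    exact hx.add hy

/-- Since `ad (a t^m)` shifts degree by `m - 1`, each of the two sums has a single surviving term.
-/
theorem hatAd_mono_apply (D Q : A →ₗ[k] A) (q : k) (m : ℤ) (a : A) (x : CTensor k fun _ => A)
    (r s : ℤ) :
    hatAd (grading k A) (bracket D Q q) (mono k A m a) x (r, s) =
      (adBlock D Q q m (r - m + 1) a).rTensor A (x (r - m + 1, s)) +
        (adBlock D Q q m (s - m + 1) a).lTensor A (x (r, s - m + 1)) := by
  rw [hatAd, Pi.add_apply,
    hatMap_apply_eq _ _ x (r, s) (r - m + 1) s (fun i h => block_ad_of_ne D Q q m i r a h)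
      (fun i h => block_coords_of_ne h),
    hatMap_apply_eq _ _ x (r, s) r (s - m + 1) (fun i h => block_coords_of_ne h)
      (fun i h => block_ad_of_ne D Q q m i s a h),
    block_coords_self, block_coords_self, block_ad D Q q m _ _ a rfl, block_ad D Q q m _ _ a rfl]
  rfl

theorem hatAd_zero_left (D Q : A →ₗ[k] A) (q : k) (x : CTensor k fun _ => A) :
    hatAd (grading k A) (bracket D Q q) 0 x = 0 := by
  rw [hatAd, map_zero, LinearMap.comp_zero, hatMap_zero_left, hatMap_zero_right, add_zero]

theorem hatAd_zero_right (D Q : A →ₗ[k] A) (q : k) (a : A ⊗[k] k[T;T⁻¹]) :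
    hatAd (grading k A) (bracket D Q q) a 0 = 0 := by
  rw [hatAd, hatMap_zero, hatMap_zero, add_zero]

theorem hatAd_add_left (D Q : A →ₗ[k] A) (q : k) (a b : A ⊗[k] k[T;T⁻¹])
    (x : CTensor k fun _ => A) :
    hatAd (grading k A) (bracket D Q q) (a + b) x =
      hatAd (grading k A) (bracket D Q q) a x + hatAd (grading k A) (bracket D Q q) b x := by
  have ha := isLocallyFinite_ad D Q q a
  have hb := isLocallyFinite_ad D Q q b
  simp only [hatAd, map_add, LinearMap.comp_add]
  rw [hatMap_add_left ha hb isLocallyFinite_coords, hatMap_add_right isLocallyFinite_coords ha hb]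
  abel

theorem hatAd_add_right (D Q : A →ₗ[k] A) (q : k) (a : A ⊗[k] k[T;T⁻¹])
    (x y : CTensor k fun _ => A) :
    hatAd (grading k A) (bracket D Q q) a (x + y) =
      hatAd (grading k A) (bracket D Q q) a x + hatAd (grading k A) (bracket D Q q) a y := by
  have ha := isLocallyFinite_ad D Q q a
  simp only [hatAd]
  rw [hatMap_add ha isLocallyFinite_coords, hatMap_add isLocallyFinite_coords ha]
  abel

end AdBlocks

/-! ### The Lie algebra structure -/

section Lie

variable {k A : Type*} [Field k] [NonUnitalCommRing A] [Module k A] [IsScalarTower k A A]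
  {D Q : A →ₗ[k] A}

theorem IsAdmissibleDiffAlgebra.twist_mul (h : IsAdmissibleDiffAlgebra D Q) (q : k) (a b : A) :
    D (a * b) + q • Q (a * b) = (D a + q • Q a) * b + (1 - q) • (a * D b) := by
  rw [h.leibniz, h.admissible, add_mul, smul_mul_assoc]
  module

variable [SMulCommClass k A A]

theorem bracket_self (D Q : A →ₗ[k] A) (q : k) (x : A ⊗[k] k[T;T⁻¹]) :
    bracket D Q q x x = 0 := by
  -- The polarised form is needed for the cross terms of `x + y` in the induction.
  have anti : ∀ x y, bracket D Q q x y + bracket D Q q y x = 0 := by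
    intro x y
    induction x using laurent_induction with
    | zero => simp
    | add x x' hx hx' =>
      rw [map_add, map_add, LinearMap.add_apply, add_add_add_comm, hx, hx', add_zero]
    | mono m a =>
      induction y using laurent_induction with
      | zero => simp
      | add y y' hy hy' =>
        rw [map_add, map_add, LinearMap.add_apply, add_add_add_comm, hy, hy', add_zero]
      | mono n b =>
        rw [bracket_mono, bracket_mono, add_comm n m]
        abel
  induction x using laurent_induction with
  | zero => simp
  | mono m a => rw [bracket_mono, sub_self]
  | add x y hx hy =>
    have := anti x y
    simp only [map_add, LinearMap.add_apply, hx, hy, zero_add, add_zero]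
    rw [add_comm, this]

theorem bracket_jacobi (h : IsAdmissibleDiffAlgebra D Q) (q : k) (x y z : A ⊗[k] k[T;T⁻¹]) :
    bracket D Q q x (bracket D Q q y z) + bracket D Q q y (bracket D Q q z x) +
      bracket D Q q z (bracket D Q q x y) = 0 := by
  induction x using laurent_induction with
  | zero => simp
  | add x x' hx hx' =>
    simp only [map_add, LinearMap.add_apply]
    -- Splitting `0` as `0 + 0` lets the two induction hypotheses be added.
    rw [← add_zero (0 : A ⊗[k] k[T;T⁻¹])]
    nth_rw 1 [← hx]
    rw [← hx']
    abel
  | mono m a =>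
  induction y using laurent_induction with
  | zero => simp
  | add x x' hx hx' =>
    simp only [map_add, LinearMap.add_apply]
    rw [← add_zero (0 : A ⊗[k] k[T;T⁻¹])]
    nth_rw 1 [← hx]
    rw [← hx']
    abel
  | mono n b =>
  induction z using laurent_induction with
  | zero => simp
  | add x x' hx hx' =>
    simp only [map_add, LinearMap.add_apply]
    rw [← add_zero (0 : A ⊗[k] k[T;T⁻¹])]
    nth_rw 1 [← hx]
    rw [← hx']
    abel
  | mono l c =>
    -- `P` is made opaque: besides commutativity and associativity, Jacobi needs only the twisted
    -- product rule `hmul`.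
    obtain ⟨P, hP⟩ : ∃ P : A →ₗ[k] A, P = D + q • Q := ⟨_, rfl⟩
    have hPa : ∀ x, D x + q • Q x = P x := by simp [hP]
    have hmul : ∀ x y, P (x * y) = P x * y + (1 - q) • (x * D y) := by
      intro x y
      rw [← hPa, ← hPa]
      exact h.twist_mul q x y
    have e1 : m + (n + l - 1) - 1 = m + n + l - 2 := by ring
    have e2 : n + (l + m - 1) - 1 = m + n + l - 2 := by ring
    have e3 : l + (m + n - 1) - 1 = m + n + l - 2 := by ring
    simp only [bracket_mono, map_sub, map_add, map_smul, hPa, hmul, e1, e2, e3, mul_add,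
      mul_smul_comm, mul_comm, mul_left_comm]
    push_cast
    module

theorem isLieBracket_bracket (h : IsAdmissibleDiffAlgebra D Q) (q : k) :
    IsLieBracket (bracket D Q q) :=
  ⟨bracket_self D Q q, bracket_jacobi h q⟩

end Lie

/-! ### The Lie coalgebra structure -/

section Coalgebra

variable {k A : Type*} [Field k] [AddCommGroup A] [Module k A] {δ : A →ₗ[k] A ⊗[k] A}
  {D Q : A →ₗ[k] A}

/-- This and the next lemmas are naturality rules. As rewrite rules they carry operators on single
tensor slots out through flips and reassociations, and order them with slot 1 outermost, then slot
2, then slot 3. -/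
theorem comm_lTensor {M N : Type*} [AddCommGroup M] [Module k M] [AddCommGroup N] [Module k N]
    (f : M →ₗ[k] N) (x : A ⊗[k] M) :
    TensorProduct.comm k A N (f.lTensor A x) = f.rTensor A (TensorProduct.comm k A M x) := by
  induction x with
  | zero => simp
  | tmul x y => simp
  | add x y hx hy => simp only [map_add, hx, hy]

theorem comm_rTensor {M N : Type*} [AddCommGroup M] [Module k M] [AddCommGroup N] [Module k N]
    (f : M →ₗ[k] N) (x : M ⊗[k] A) :
    TensorProduct.comm k N A (f.rTensor A x) = f.lTensor A (TensorProduct.comm k M A x) := by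
  induction x with
  | zero => simp
  | tmul x y => simp
  | add x y hx hy => simp only [map_add, hx, hy]

theorem lTensor_rTensor_comm {M N M' N' : Type*} [AddCommGroup M] [Module k M] [AddCommGroup N]
    [Module k N] [AddCommGroup M'] [Module k M'] [AddCommGroup N'] [Module k N']
    (f : M →ₗ[k] N) (g : M' →ₗ[k] N') (x : M' ⊗[k] M) :
    f.lTensor N' (g.rTensor M x) = g.rTensor N (f.lTensor M' x) := by
  induction x with
  | zero => simp
  | tmul x y => simp
  | add x y hx hy => simp only [map_add, hx, hy]

theorem lTensor_lTensor_rTensor_comm (f g : A →ₗ[k] A) (x : A ⊗[k] (A ⊗[k] A)) :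
    (f.lTensor A).lTensor A ((g.rTensor A).lTensor A x) =
      (g.rTensor A).lTensor A ((f.lTensor A).lTensor A x) := by
  rw [← LinearMap.lTensor_comp_apply, ← LinearMap.lTensor_comp_apply]
  congr 2
  ext
  simp

theorem leftComm_rTensor (f : A →ₗ[k] A) (x : A ⊗[k] (A ⊗[k] A)) :
    TensorProduct.leftComm k A A A (f.rTensor (A ⊗[k] A) x) =
      (f.rTensor A).lTensor A (TensorProduct.leftComm k A A A x) := by
  have : (TensorProduct.leftComm k A A A).toLinearMap ∘ₗ f.rTensor (A ⊗[k] A) =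
      (f.rTensor A).lTensor A ∘ₗ (TensorProduct.leftComm k A A A).toLinearMap := by
    ext; simp
  exact LinearMap.congr_fun this x

theorem leftComm_lTensor_rTensor (f : A →ₗ[k] A) (x : A ⊗[k] (A ⊗[k] A)) :
    TensorProduct.leftComm k A A A ((f.rTensor A).lTensor A x) =
      f.rTensor (A ⊗[k] A) (TensorProduct.leftComm k A A A x) := by
  have : (TensorProduct.leftComm k A A A).toLinearMap ∘ₗ (f.rTensor A).lTensor A =
      f.rTensor (A ⊗[k] A) ∘ₗ (TensorProduct.leftComm k A A A).toLinearMap := by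
    ext; simp
  exact LinearMap.congr_fun this x

theorem leftComm_lTensor_lTensor (f : A →ₗ[k] A) (x : A ⊗[k] (A ⊗[k] A)) :
    TensorProduct.leftComm k A A A ((f.lTensor A).lTensor A x) =
      (f.lTensor A).lTensor A (TensorProduct.leftComm k A A A x) := by
  have : (TensorProduct.leftComm k A A A).toLinearMap ∘ₗ (f.lTensor A).lTensor A =
      (f.lTensor A).lTensor A ∘ₗ (TensorProduct.leftComm k A A A).toLinearMap := by
    ext; simp
  exact LinearMap.congr_fun this x

theorem assoc_rTensor_rTensor (f : A →ₗ[k] A) (x : (A ⊗[k] A) ⊗[k] A) :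
    TensorProduct.assoc k A A A ((f.rTensor A).rTensor A x) =
      f.rTensor (A ⊗[k] A) (TensorProduct.assoc k A A A x) := by
  have : (TensorProduct.assoc k A A A).toLinearMap ∘ₗ (f.rTensor A).rTensor A =
      f.rTensor (A ⊗[k] A) ∘ₗ (TensorProduct.assoc k A A A).toLinearMap := by
    ext; simp
  exact LinearMap.congr_fun this x

theorem assoc_rTensor_lTensor (f : A →ₗ[k] A) (x : (A ⊗[k] A) ⊗[k] A) :
    TensorProduct.assoc k A A A ((f.lTensor A).rTensor A x) =
      (f.rTensor A).lTensor A (TensorProduct.assoc k A A A x) := by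
  have : (TensorProduct.assoc k A A A).toLinearMap ∘ₗ (f.lTensor A).rTensor A =
      (f.rTensor A).lTensor A ∘ₗ (TensorProduct.assoc k A A A).toLinearMap := by
    ext; simp
  exact LinearMap.congr_fun this x

theorem assoc_rTensor_lTensor_apply (δ : A →ₗ[k] A ⊗[k] A) (f : A →ₗ[k] A) (x : A ⊗[k] A) :
    TensorProduct.assoc k A A A (δ.rTensor A (f.lTensor A x)) =
      (f.lTensor A).lTensor A (TensorProduct.assoc k A A A (δ.rTensor A x)) := by
  have : (TensorProduct.assoc k A A A).toLinearMap ∘ₗ f.lTensor (A ⊗[k] A) =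
      (f.lTensor A).lTensor A ∘ₗ (TensorProduct.assoc k A A A).toLinearMap := by
    ext; simp
  rw [← lTensor_rTensor_comm]
  exact LinearMap.congr_fun this _

end Coalgebra

/-! ### Coproduct identities for `D` and `E`, and co-Jacobi -/

section Coalgebra

variable {k A : Type*} [Field k] [NonUnitalCommRing A] [Module k A]
  {δ : A →ₗ[k] A ⊗[k] A} {D E : A →ₗ[k] A}

/-- By coassociativity the iterated coproduct is also `(δ ⊗ id) δ`, where swapping the first two
slots only flips an output of `δ`. -/
theorem IsCocommutative.leftComm_iterate (hc : IsCocommutative δ) (ha : IsCoassociative δ) (a : A) :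
    TensorProduct.leftComm k A A A (δ.lTensor A (δ a)) = δ.lTensor A (δ a) := by
  have h1 : ∀ x : A ⊗[k] A, TensorProduct.leftComm k A A A
      (TensorProduct.assoc k A A A (δ.rTensor A x)) =
        TensorProduct.assoc k A A A (δ.rTensor A x) := by
    intro x
    have : ∀ y : (A ⊗[k] A) ⊗[k] A, TensorProduct.leftComm k A A A
        (TensorProduct.assoc k A A A y) = TensorProduct.assoc k A A A
          ((TensorProduct.comm k A A).toLinearMap.rTensor A y) := by
      intro y
      have : (TensorProduct.leftComm k A A A).toLinearMap ∘ₗ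
          (TensorProduct.assoc k A A A).toLinearMap =
          (TensorProduct.assoc k A A A).toLinearMap ∘ₗ
            (TensorProduct.comm k A A).toLinearMap.rTensor A := by
        ext; simp
      exact LinearMap.congr_fun this y
    rw [this, ← LinearMap.rTensor_comp_apply]
    congr 3
    ext a
    exact (hc a).symm
  have h2 := LinearMap.congr_fun ha a
  simp only [LinearMap.comp_apply, LinearEquiv.coe_coe] at h2
  rw [← h2, h1]

/-- With `E = D + Q`, the map `E` is colinear. -/
theorem IsAdmissibleDiffCoalgebra.map_centroid (h : IsAdmissibleDiffCoalgebra δ (E - D) D)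
    (a : A) : δ (E a) = E.rTensor A (δ a) := by
  have h1 := h.coderivation a
  have h2 := h.admissible a
  have : E a = (E - D) a + D a := by simp
  rw [this, map_add, h1, ← h2]
  simp only [LinearMap.rTensor_sub, LinearMap.sub_apply]
  abel

/-- Cocommutativity at `E a` and at `a` carries colinearity from the first slot to the second. -/
theorem IsAdmissibleDiffCoalgebra.lTensor_centroid (h : IsAdmissibleDiffCoalgebra δ (E - D) D)
    (a : A) : E.lTensor A (δ a) = E.rTensor A (δ a) := by
  rw [← h.map_centroid, h.cocomm (E a), h.map_centroid, comm_rTensor, ← h.cocomm]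

theorem IsAdmissibleDiffCoalgebra.map_derivation (h : IsAdmissibleDiffCoalgebra δ (E - D) D)
    (a : A) : δ (D a) = D.rTensor A (δ a) + D.lTensor A (δ a) - E.rTensor A (δ a) := by
  rw [← h.admissible, LinearMap.lTensor_sub, LinearMap.sub_apply, h.lTensor_centroid]
  abel

/-- Cocommutativity absorbs the flip, so both terms are the same operator, acting in different slots
of `δ a`. -/
theorem cobracketBlock_apply (hc : IsCocommutative δ) (q : k) (r s : ℤ) (a : A) :
    cobracketBlock δ D (E - D) q r s a =
      ((s : k) + 1) • (E - (1 - q) • D).rTensor A (δ a) -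
        ((r : k) + 1) • (E - (1 - q) • D).lTensor A (δ a) := by
  have hR : E - D + q • D = E - (1 - q) • D := by module
  simp only [cobracketBlock, coprod, LinearMap.sub_apply, LinearMap.smul_apply,
    LinearMap.comp_apply, LinearEquiv.coe_coe, comm_lTensor, ← hc a, hR]

theorem cobracketBlock_eq (hc : IsCocommutative δ) (q : k) (r s : ℤ) :
    cobracketBlock δ D (E - D) q r s =
      ((s : k) + 1) • (E.rTensor A ∘ₗ δ - (1 - q) • D.rTensor A ∘ₗ δ) -
        ((r : k) + 1) • (E.lTensor A ∘ₗ δ - (1 - q) • D.lTensor A ∘ₗ δ) := by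
  ext a
  rw [cobracketBlock_apply hc]
  simp [LinearMap.rTensor_sub, LinearMap.lTensor_sub, LinearMap.rTensor_smul,
    LinearMap.lTensor_smul]

/-- All terms become slot operators on the iterated coproduct of `a`. It is fixed by the swap of the
first two slots, and `E` acts on it equally in all three slots; after that the coefficients cancel.
-/
theorem cobracketBlock_cojacobi (h : IsAdmissibleDiffCoalgebra δ (E - D) D) (q : k) (r s u : ℤ)
    (a : A) :
    (cobracketBlock δ D (E - D) q s u).lTensor A (cobracketBlock δ D (E - D) q r (s + u + 2) a) -
      TensorProduct.leftComm k A A A ((cobracketBlock δ D (E - D) q r u).lTensor A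
        (cobracketBlock δ D (E - D) q s (r + u + 2) a)) =
      TensorProduct.assoc k A A A ((cobracketBlock δ D (E - D) q r s).rTensor A
        (cobracketBlock δ D (E - D) q (r + s + 2) u a)) := by
  have hdE : δ ∘ₗ E = E.rTensor A ∘ₗ δ := LinearMap.ext h.map_centroid
  have hEE : E.lTensor A ∘ₗ δ = E.rTensor A ∘ₗ δ := LinearMap.ext h.lTensor_centroid
  have hdD : δ ∘ₗ D = D.rTensor A ∘ₗ δ + D.lTensor A ∘ₗ δ - E.rTensor A ∘ₗ δ :=
    LinearMap.ext h.map_derivation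
  have lE : ∀ x, δ.lTensor A (E.lTensor A x) = (E.rTensor A).lTensor A (δ.lTensor A x) := by
    intro x
    rw [← LinearMap.lTensor_comp_apply, hdE, LinearMap.lTensor_comp_apply]
  have lD : ∀ x, δ.lTensor A (D.lTensor A x) = (D.rTensor A).lTensor A (δ.lTensor A x) +
      (D.lTensor A).lTensor A (δ.lTensor A x) - (E.rTensor A).lTensor A (δ.lTensor A x) := by
    intro x
    rw [← LinearMap.lTensor_comp_apply, hdD]
    simp only [LinearMap.lTensor_sub, LinearMap.lTensor_add, LinearMap.sub_apply,
      LinearMap.add_apply, LinearMap.lTensor_comp_apply]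
  have rE : ∀ x, δ.rTensor A (E.rTensor A x) = (E.rTensor A).rTensor A (δ.rTensor A x) := by
    intro x
    rw [← LinearMap.rTensor_comp_apply, hdE, LinearMap.rTensor_comp_apply]
  have rD : ∀ x, δ.rTensor A (D.rTensor A x) = (D.rTensor A).rTensor A (δ.rTensor A x) +
      (D.lTensor A).rTensor A (δ.rTensor A x) - (E.rTensor A).rTensor A (δ.rTensor A x) := by
    intro x
    rw [← LinearMap.rTensor_comp_apply, hdD]
    simp only [LinearMap.rTensor_sub, LinearMap.rTensor_add, LinearMap.sub_apply,
      LinearMap.add_apply, LinearMap.rTensor_comp_apply]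
  have hw : TensorProduct.assoc k A A A (δ.rTensor A (δ a)) = δ.lTensor A (δ a) :=
    LinearMap.congr_fun h.coassoc a
  have hf := h.cocomm.leftComm_iterate h.coassoc a
  -- `hE2` and `hE3` move `E` to slot 1; `hE23` does so past an operator in slot 3.
  have hE2 : (E.rTensor A).lTensor A (δ.lTensor A (δ a)) =
      E.rTensor (A ⊗[k] A) (δ.lTensor A (δ a)) := by
    rw [← lE, h.lTensor_centroid, lTensor_rTensor_comm]
  have hE3 : (E.lTensor A).lTensor A (δ.lTensor A (δ a)) =
      E.rTensor (A ⊗[k] A) (δ.lTensor A (δ a)) := by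
    rw [← hE2, ← LinearMap.lTensor_comp_apply, hEE, LinearMap.lTensor_comp_apply]
  have hE23 : ∀ f : A →ₗ[k] A,
      (E.rTensor A).lTensor A ((f.lTensor A).lTensor A (δ.lTensor A (δ a))) =
        E.rTensor (A ⊗[k] A) ((f.lTensor A).lTensor A (δ.lTensor A (δ a))) := by
    intro f
    rw [← lTensor_lTensor_rTensor_comm, hE2, lTensor_rTensor_comm]
  simp only [cobracketBlock_eq h.cocomm, LinearMap.sub_apply, LinearMap.smul_apply,
    LinearMap.comp_apply, LinearMap.lTensor_sub, LinearMap.lTensor_smul, LinearMap.rTensor_sub,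
    LinearMap.rTensor_smul, LinearMap.lTensor_comp_apply, LinearMap.rTensor_comp_apply, map_sub,
    map_add, map_smul, lD, rE, rD, h.lTensor_centroid, assoc_rTensor_rTensor,
    assoc_rTensor_lTensor, assoc_rTensor_lTensor_apply, leftComm_rTensor, leftComm_lTensor_rTensor,
    leftComm_lTensor_lTensor, lTensor_rTensor_comm, hw, hf, lTensor_lTensor_rTensor_comm, hE2, hE3,
    hE23]
  push_cast
  module

end Coalgebra

/-! ### Compatibility of the bracket and the cobracket -/

section Compatibility

variable {k A : Type*} [Field k] [NonUnitalCommRing A] [Module k A] {δ : A →ₗ[k] A ⊗[k] A} {D E : A →ₗ[k] A}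

/-- In the sum of the rules for `D (b * a)` and `(E - D) (b * a)` the terms `b * D a` cancel. -/
theorem IsAdmissibleDiffAlgebra.centroid_mul (h : IsAdmissibleDiffAlgebra D (E - D)) (a b : A) :
    E (a * b) = a * E b := by
  have h1 := h.admissible b a
  have h2 := h.leibniz b a
  rw [LinearMap.sub_apply, h2, sub_eq_iff_eq_add, LinearMap.sub_apply, sub_mul] at h1
  rw [mul_comm a b, h1, mul_comm a]
  abel

/-- The commutator `[E, D]` acts equally on both tensor factors of `δ a`. -/
theorem IsAdmissibleDiffCoalgebra.commutator_exchange
    (h : IsAdmissibleDiffCoalgebra δ (E - D) D) (a : A) :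
    E.rTensor A (D.rTensor A (δ a)) - D.rTensor A (E.rTensor A (δ a)) =
      E.lTensor A (D.lTensor A (δ a)) - D.lTensor A (E.rTensor A (δ a)) := by
  -- Colinearity of `E` at `D a`, with `δ (D a)` expanded, is the claim up to rearrangement.
  have h1 := h.lTensor_centroid (D a)
  simp only [h.map_derivation, map_add, map_sub, lTensor_rTensor_comm, h.lTensor_centroid] at h1
  rw [lTensor_rTensor_comm]
  linear_combination (norm := module) (-1 : k) • h1

/-! ### Slot operators and multiplication -/

section MulLeft

variable [SMulCommClass k A A]

theorem rTensor_derivation_mulLeft (hD : ∀ a b, D (a * b) = D a * b + a * D b) (a : A)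
    (x : A ⊗[k] A) :
    D.rTensor A ((LinearMap.mulLeft k a).rTensor A x) =
      (LinearMap.mulLeft k (D a)).rTensor A x + (LinearMap.mulLeft k a).rTensor A (D.rTensor A x) := by
  rw [← LinearMap.rTensor_comp_apply, ← LinearMap.rTensor_comp_apply, ← LinearMap.add_apply,
    ← LinearMap.rTensor_add]
  congr 2
  ext x
  simp [hD]

theorem lTensor_derivation_mulLeft (hD : ∀ a b, D (a * b) = D a * b + a * D b) (a : A)
    (x : A ⊗[k] A) :
    D.lTensor A ((LinearMap.mulLeft k a).lTensor A x) =
      (LinearMap.mulLeft k (D a)).lTensor A x + (LinearMap.mulLeft k a).lTensor A (D.lTensor A x) := by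
  rw [← LinearMap.lTensor_comp_apply, ← LinearMap.lTensor_comp_apply, ← LinearMap.add_apply,
    ← LinearMap.lTensor_add]
  congr 2
  ext x
  simp [hD]

theorem rTensor_centroid_mulLeft (hE : ∀ a b, E (a * b) = a * E b) (a : A) (x : A ⊗[k] A) :
    E.rTensor A ((LinearMap.mulLeft k a).rTensor A x) =
      (LinearMap.mulLeft k a).rTensor A (E.rTensor A x) := by
  rw [← LinearMap.rTensor_comp_apply, ← LinearMap.rTensor_comp_apply]
  congr 2
  ext x
  simp [hE]

theorem lTensor_centroid_mulLeft (hE : ∀ a b, E (a * b) = a * E b) (a : A) (x : A ⊗[k] A) :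
    E.lTensor A ((LinearMap.mulLeft k a).lTensor A x) =
      (LinearMap.mulLeft k a).lTensor A (E.lTensor A x) := by
  rw [← LinearMap.lTensor_comp_apply, ← LinearMap.lTensor_comp_apply]
  congr 2
  ext x
  simp [hE]

theorem mulLeft_centroid (hE : ∀ a b, E (a * b) = a * E b) (a : A) :
    LinearMap.mulLeft k (E a) = LinearMap.mulLeft k a ∘ₗ E := by
  ext x
  simp only [LinearMap.mulLeft_apply, LinearMap.comp_apply]
  rw [← hE, mul_comm a x, hE, mul_comm]

end MulLeft

variable [IsScalarTower k A A] [SMulCommClass k A A]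

theorem IsASIBialgebra.map_mul_left (h : IsASIBialgebra δ) (a b : A) :
    δ (a * b) = (LinearMap.mulLeft k a).lTensor A (δ b) +
      (LinearMap.mulLeft k b).rTensor A (δ a) := by
  have : LinearMap.mulRight k b = LinearMap.mulLeft k b := by
    ext x
    simp [mul_comm]
  rw [h.map_mul, this]

/-- The two expressions of `δ (a b) = δ (b a)`. -/
theorem IsASIBialgebra.mul_exchange (h : IsASIBialgebra δ) (a b : A) :
    (LinearMap.mulLeft k b).rTensor A (δ a) + (LinearMap.mulLeft k a).lTensor A (δ b) =
      (LinearMap.mulLeft k b).lTensor A (δ a) + (LinearMap.mulLeft k a).rTensor A (δ b) := by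
  rw [add_comm, ← h.map_mul_left, mul_comm a b, h.map_mul_left]

/-- Both sides are expanded into words in `D`, `E` and multiplications on the slots of `δ a` and `δ
b`. Their difference is a combination of consequences of `mul_exchange` and `commutator_exchange`,
with coefficients polynomial in the degrees. -/
theorem cobracketBlock_compatible [CharZero k] (h : IsDiffASIBialgebra δ D (E - D))
    {q : k} (hq : q = -1 / 2 ∨ E = 0) (m n r s : ℤ) (hrs : r + s = m + n - 3) (a b : A) :
    cobracketBlock δ D (E - D) q r s (adBlock D (E - D) q m n a b) =
      ((adBlock D (E - D) q m (r - m + 1) a).rTensor A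
          (cobracketBlock δ D (E - D) q (r - m + 1) s b) +
        (adBlock D (E - D) q m (s - m + 1) a).lTensor A
          (cobracketBlock δ D (E - D) q r (s - m + 1) b)) -
      ((adBlock D (E - D) q n (r - n + 1) b).rTensor A
          (cobracketBlock δ D (E - D) q (r - n + 1) s a) +
        (adBlock D (E - D) q n (s - n + 1) b).lTensor A
          (cobracketBlock δ D (E - D) q r (s - n + 1) a)) := by
  obtain rfl : n = r + s + 3 - m := by omega
  have hD := h.algebra.leibniz
  have hE := h.algebra.centroid_mul
  have lE := h.coalgebra.lTensor_centroid
  have hmulE : LinearMap.mulLeft k (E b) = LinearMap.mulLeft k b ∘ₗ E := mulLeft_centroid hE b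
  -- Uses `D + qQ = (1-q)D + qE` and trades multiplication by `E x` for `E` followed by
  -- multiplication by `x`.
  have had : ∀ (m i : ℤ) (x : A), adBlock D (E - D) q m i x =
      (m : k) • ((1 - q) • LinearMap.mulLeft k x ∘ₗ D + q • LinearMap.mulLeft k x ∘ₗ E) -
        (i : k) • ((1 - q) • LinearMap.mulLeft k (D x) + q • LinearMap.mulLeft k x ∘ₗ E) := by
    intro m i x
    ext y
    have hxy : E x * y = x * E y := by rw [mul_comm, ← hE, mul_comm, hE]
    simp only [adBlock, LinearMap.sub_apply, LinearMap.add_apply, LinearMap.smul_apply,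
      LinearMap.comp_apply, LinearMap.mulLeft_apply, mul_add, add_mul, mul_sub, sub_mul,
      mul_smul_comm, smul_mul_assoc, hxy]
    module
  have hT := h.asi.mul_exchange a b
  have hTb := h.asi.mul_exchange a (D b)
  have hTab := h.asi.mul_exchange (D a) (D b)
  have hFa := congrArg ((LinearMap.mulLeft k b).rTensor A) (h.coalgebra.commutator_exchange a)
  have hFb := congrArg ((LinearMap.mulLeft k a).rTensor A) (h.coalgebra.commutator_exchange b)
  have dD := h.coalgebra.map_derivation
  have dE := h.coalgebra.map_centroid
  have dM := h.asi.map_mul_left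
  have rD := rTensor_derivation_mulLeft (k := k) hD
  have lD := lTensor_derivation_mulLeft (k := k) hD
  have rEm := rTensor_centroid_mulLeft (k := k) hE
  have lEm := lTensor_centroid_mulLeft (k := k) hE
  have hD1 := congrArg (D.rTensor A) hTb
  have hE1 := congrArg (E.rTensor A) hTb
  have hD2 := congrArg (D.lTensor A) hTb
  have hE2 := congrArg (E.lTensor A) hTb
  have hD1E1 := congrArg (fun x => D.rTensor A (E.rTensor A x)) hT
  have hD1D2 := congrArg (fun x => D.rTensor A (D.lTensor A x)) hT
  have hD2D2 := congrArg (fun x => D.lTensor A (D.lTensor A x)) hT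
  have hE1E1 := congrArg (fun x => E.rTensor A (E.rTensor A x)) hT
  have hE1D2 := congrArg (fun x => E.rTensor A (D.lTensor A x)) hT
  have hE2D2 := congrArg (fun x => E.lTensor A (D.lTensor A x)) hT
  simp only [map_add, map_sub, lTensor_rTensor_comm, dD, rD, lD, rEm, lEm, lE]
    at hD1 hE1 hD2 hE2 hTab hFa hFb hD1E1 hD1D2 hD2D2 hE1E1 hE1D2 hE2D2
  simp only [cobracketBlock_apply h.coalgebra.cocomm, had, LinearMap.sub_apply,
    LinearMap.add_apply, LinearMap.smul_apply, LinearMap.comp_apply, LinearMap.mulLeft_apply,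
    LinearMap.rTensor_add, LinearMap.rTensor_sub, LinearMap.rTensor_smul,
    LinearMap.rTensor_comp_apply, LinearMap.lTensor_add, LinearMap.lTensor_sub,
    LinearMap.lTensor_smul, LinearMap.lTensor_comp_apply,
    hmulE, map_add, map_sub, map_smul, lTensor_rTensor_comm, dD, dE, dM, rD, lD, rEm, lEm,
    lE]
  push_cast
  generalize (m : k) = x, (r : k) = y, (s : k) = z
  -- The identities built from `D` alone have the same coefficients in both cases: at `q = -1/2` the
  -- factor `(1-q)^2` is `9/4`. The others in the first case account for words containing `E`, and
  -- are not needed when `E = 0`.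
  rcases hq with rfl | rfl
  · linear_combination (norm := module)
      (3 / 2 * x ^ 2 - 3 / 4 * z * x - 3 * y * x + 3 / 4 * y * z + 3 / 2 * y ^ 2 - 21 / 4
        * x + 3 / 4 * z + 21 / 4 * y + 15 / 4) • hD1E1 +
      (-9 / 4 * x ^ 2 + 9 / 4 * z * x + 9 / 2 * y * x - 9 / 4 * y * z - 9 / 4 * y ^ 2 + 9
        * x - 9 / 4 * z - 9 * y - 27 / 4) • hD1D2 +
      (-x ^ 2 + 1 / 2 * z * x + 3 * y * x - y * z - 2 * y ^ 2 + 9 / 2 * x - z - 7 * y - 5)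
        • hE1E1 +
      (3 / 2 * x ^ 2 - 3 / 2 * z * x - 9 / 2 * y * x + 3 * y * z + 3 * y ^ 2 - 15 / 2 * x
        + 3 * z + 12 * y + 9) • hE1D2 +
      (9 / 4 * y * x - 9 / 4 * y * z - 9 / 4 * y ^ 2 + 9 / 4 * x - 9 / 4 * z - 9 * y - 27
        / 4) • hD2D2 +
      (-3 / 2 * y * x + 3 / 4 * y * z + 3 / 2 * y ^ 2 - 3 / 2 * x + 3 / 4 * z + 21 / 4 * y
        + 15 / 4) • hE2D2 +
      (-9 / 4 * z * x - 9 / 4 * x) • hD1 +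
      (3 / 2 * z * x + 3 / 2 * x) • hE1 +
      (-9 / 4 * y * x + 9 / 4 * y * z + 9 / 4 * y ^ 2 - 9 / 4 * x + 9 / 4 * z + 9 * y + 27
        / 4) • hD2 +
      (3 / 2 * y * x - 3 / 2 * y * z - 3 / 2 * y ^ 2 + 3 / 2 * x - 3 / 2 * z - 6 * y - 9 /
        2) • hE2 +
      (-3 / 4 * y * z - 3 / 4 * z - 3 / 4 * y - 3 / 4) • hFa +
      (3 / 4 * y * z + 3 / 4 * z + 3 / 4 * y + 3 / 4) • hFb +
      (9 / 4 * y * z + 9 / 4 * z + 9 / 4 * y + 9 / 4) • hTab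
  · simp only [LinearMap.rTensor_zero, LinearMap.lTensor_zero, LinearMap.zero_apply, map_zero] at *
    linear_combination (norm := module)
      ((1 - q) ^ 2 * (-x ^ 2 + z * x + 2 * y * x - y * z - y ^ 2 + 4 * x - z - 4 * y - 3))
        • hD1D2 +
      ((1 - q) ^ 2 * (y * x - y * z - y ^ 2 + x - z - 4 * y - 3)) • hD2D2 +
      ((1 - q) ^ 2 * (-z * x - x)) • hD1 +
      ((1 - q) ^ 2 * (-y * x + y * z + y ^ 2 - x + z + 4 * y + 3)) • hD2 +
      ((1 - q) ^ 2 * (y * z + z + y + 1)) • hTab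

end Compatibility

/-! ### From components to the completed Lie bialgebra -/

section Main

variable {k A : Type*} [Field k] [NonUnitalCommRing A] [Module k A] {δ : A →ₗ[k] A ⊗[k] A}
  {D E : A →ₗ[k] A}

theorem cobracket_antisymm (δ : A →ₗ[k] A ⊗[k] A) (D Q : A →ₗ[k] A) (q : k)
    (x : A ⊗[k] k[T;T⁻¹]) : cobracket δ D Q q x = -hatFlip (cobracket δ D Q q x) := by
  induction x using laurent_induction with
  | zero =>
    funext p
    simp [hatFlip]
  | add x y hx hy =>
    funext p
    have h1 := congrFun hx p
    have h2 := congrFun hy p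
    simp only [Pi.neg_apply, hatFlip, map_add, Pi.add_apply] at h1 h2 ⊢
    nth_rw 1 [h1, h2]
    abel
  | mono m a =>
    funext ⟨r, s⟩
    simp only [Pi.neg_apply, hatFlip, cobracket_mono]
    by_cases h : r + s = m - 2
    · rw [if_pos h, if_pos (by omega)]
      simp only [map_sub, map_smul, TensorProduct.comm_comm]
      abel
    · rw [if_neg h, if_neg (by omega)]
      simp

theorem cobracket_cojacobi (h : IsAdmissibleDiffCoalgebra δ (E - D) D) (q : k)
    (x : A ⊗[k] k[T;T⁻¹]) :
    hatMap (grading k A) (coords (grading k A)) (cobracket δ D (E - D) q)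
        (cobracket δ D (E - D) q x) -
      hatFlip₃ (V := fun _ => A) (hatMap (grading k A) (coords (grading k A)) (cobracket δ D (E - D) q)
        (cobracket δ D (E - D) q x)) =
      hatAssoc (V := fun _ => A) (hatMap (grading k A) (cobracket δ D (E - D) q) (coords (grading k A))
        (cobracket δ D (E - D) q x)) := by
  funext ⟨r, s, u⟩
  simp only [Pi.sub_apply, hatFlip₃, hatAssoc, hatMap_coords_cobracket_apply,
    hatMap_cobracket_coords_apply]
  induction x using laurent_induction with
  | zero => simp
  | add x y hx hy =>
    simp only [map_add, Pi.add_apply]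
    rw [← hx, ← hy]
    abel
  | mono m a =>
    simp only [cobracket_mono_eq]
    -- Each of the two cobrackets lowers total degree by 2.
    by_cases hm : r + s + u = m - 4
    · rw [if_pos (by omega), if_pos (by omega), if_pos (by omega)]
      exact cobracketBlock_cojacobi h q r s u a
    · rw [if_neg (by omega), if_neg (by omega), if_neg (by omega)]
      simp

/-- The cobracket sees `Q` only through `(id ⊗ Q) δ`. -/
theorem cobracket_congr {Q Q' : A →ₗ[k] A} (hQ : Q.lTensor A ∘ₗ δ = Q'.lTensor A ∘ₗ δ) (q : k) :
    cobracket δ D Q q = cobracket δ D Q' q := by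
  have : coprod δ D Q q = coprod δ D Q' q := by
    simp only [coprod, LinearMap.lTensor_add, LinearMap.add_comp, hQ]
  have hm : cobracketAt δ D Q q = cobracketAt δ D Q' q := by
    funext m
    simp only [cobracketAt, cobracketTerm, this]
  rw [cobracket, cobracket, hm]

variable [IsScalarTower k A A] [SMulCommClass k A A]

theorem bracket_mono_eq (D Q : A →ₗ[k] A) (q : k) (m n : ℤ) (a b : A) :
    bracket D Q q (mono k A m a) (mono k A n b) =
      mono k A (m + n - 1) (adBlock D Q q m n a b) := by
  rw [bracket_mono, mul_comm b]
  simp [adBlock]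

theorem cobracket_bracket [CharZero k] (h : IsDiffASIBialgebra δ D (E - D)) {q : k}
    (hq : q = -1 / 2 ∨ E = 0) (x y : A ⊗[k] k[T;T⁻¹]) :
    cobracket δ D (E - D) q (bracket D (E - D) q x y) =
      hatAd (grading k A) (bracket D (E - D) q) x (cobracket δ D (E - D) q y) -
        hatAd (grading k A) (bracket D (E - D) q) y (cobracket δ D (E - D) q x) := by
  induction x using laurent_induction with
  | zero => simp [hatAd_zero_left, hatAd_zero_right]
  | add x x' hx hx' =>
    simp only [map_add, LinearMap.add_apply, hatAd_add_left, hatAd_add_right, hx, hx']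
    abel
  | mono m a =>
  induction y using laurent_induction with
  | zero => simp [hatAd_zero_left, hatAd_zero_right]
  | add y y' hy hy' =>
    simp only [map_add, hatAd_add_left, hatAd_add_right, hy, hy']
    abel
  | mono n b =>
    funext ⟨r, s⟩
    rw [Pi.sub_apply, hatAd_mono_apply, hatAd_mono_apply, bracket_mono_eq]
    simp only [cobracket_mono_eq]
    -- The bracket lowers degree by 1 and the cobracket by 2; off this line all five components
    -- vanish.
    by_cases hrs : r + s = m + n - 3
    · rw [if_pos (by omega), if_pos (by omega), if_pos (by omega), if_pos (by omega),
        if_pos (by omega)]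
      exact cobracketBlock_compatible h hq m n r s hrs a b
    · rw [if_neg (by omega), if_neg (by omega), if_neg (by omega), if_neg (by omega),
        if_neg (by omega)]
      simp

theorem isCompletedLieBialgebra_of_eq_or [CharZero k] [FiniteDimensional k A] {Q : A →ₗ[k] A}
    (h : IsDiffASIBialgebra δ D Q) {q : k} (hq : q = -1 / 2 ∨ Q = -D) :
    IsCompletedLieBialgebra (grading k A) (bracket D Q q) (cobracket δ D Q q) := by
  -- In terms of `E = Q + D`, the alternative `Q = -D` is `E = 0`.
  obtain ⟨E, rfl⟩ : ∃ E, Q = E - D := ⟨Q + D, by abel⟩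
  refine ⟨isLieBracket_bracket h.algebra q,
    ⟨fun _ => inferInstance, isLocallyFinite_cobracket δ D _ q, cobracket_antisymm δ D _ q,
      cobracket_cojacobi h.coalgebra q⟩, isLocallyFinite_ad D _ q, cobracket_bracket h ?_⟩
  exact hq.imp_right fun h => by simpa [sub_eq_add_neg] using h

/-- If `(id ⊗ Q) δ = -(id ⊗ D) δ`, then `Q` may be replaced by `-D`. -/
theorem IsDiffASIBialgebra.replace_neg {Q : A →ₗ[k] A} (h : IsDiffASIBialgebra δ D Q)
    (hδ : Q.lTensor A ∘ₗ δ = -(D.lTensor A ∘ₗ δ)) : IsDiffASIBialgebra δ D (-D) := by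
  have hl : ∀ a, (-D).lTensor A (δ a) = Q.lTensor A (δ a) := fun a => by
    rw [LinearMap.lTensor_neg]
    exact (LinearMap.congr_fun hδ a).symm
  refine ⟨h.asi, ⟨h.algebra.leibniz, fun a b => ?_⟩,
    ⟨h.coalgebra.coassoc, h.coalgebra.cocomm, fun a => ?_, fun a => ?_⟩⟩
  · rw [LinearMap.neg_apply, h.algebra.leibniz, LinearMap.neg_apply, neg_mul]
    abel
  · rw [hl, LinearMap.neg_apply, map_neg, ← h.coalgebra.admissible, LinearMap.rTensor_neg,
      LinearMap.neg_apply]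
    abel
  · rw [hl, h.coalgebra.admissible]

theorem bracket_congr {Q Q' : A →ₗ[k] A} (hQ : ∀ a b : A, a * Q b = a * Q' b) (q : k) :
    bracket D Q q = bracket D Q' q := by
  have : circ D Q q = circ D Q' q := by
    ext a b
    simp [circ, mul_add, hQ, mul_smul_comm]
  have hm : ∀ m n, bracketAt D Q q m n = bracketAt D Q' q m n := fun m n => by
    rw [bracketAt, bracketAt, this]
  simp only [bracket, hm]

end Main

end CompletedLie

end

theorem theorem2p20 {k A : Type*} [Field k] [CharZero k] [NonUnitalCommRing A] [Module k A]
    [IsScalarTower k A A] [SMulCommClass k A A] [FiniteDimensional k A]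
    (δ : A →ₗ[k] A ⊗[k] A) (D Q : A →ₗ[k] A)
    (h : CompletedLie.IsDiffASIBialgebra δ D Q) :
    CompletedLie.IsCompletedLieBialgebra (CompletedLie.grading k A)
        (CompletedLie.bracket D Q (-1 / 2)) (CompletedLie.cobracket δ D Q (-1 / 2)) ∧
      ((∀ a b : A, a * Q b = -(a * D b)) →
        Q.lTensor A ∘ₗ δ = -(D.lTensor A ∘ₗ δ) →
        ∀ q : k, CompletedLie.IsCompletedLieBialgebra (CompletedLie.grading k A)
          (CompletedLie.bracket D Q q) (CompletedLie.cobracket δ D Q q)) := by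
  refine ⟨CompletedLie.isCompletedLieBialgebra_of_eq_or h (Or.inl rfl), fun hQ hδ q => ?_⟩
  -- Without a unit or counit `Q` need not equal `-D`, but the two are indistinguishable inside
  -- products and after `δ`, which is all that the bracket and the cobracket use.
  have hδ' : Q.lTensor A ∘ₗ δ = (-D).lTensor A ∘ₗ δ := by
    rw [hδ, LinearMap.lTensor_neg, LinearMap.neg_comp]
  rw [CompletedLie.bracket_congr (Q' := -D) (fun a b => by simp [hQ]) q,
    CompletedLie.cobracket_congr hδ' q]
  exact CompletedLie.isCompletedLieBialgebra_of_eq_or (h.replace_neg hδ) (Or.inr rfl)
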